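/- All spaces are over $\mathbb{R}$. Let $1\le p,p'\le\infty$ with $\frac1p+\frac1{p'}=1$. **Definitions.** A *$p$-multinormed space* is a Banach space $X$ together with norms $\|\cdot\|_n$ on $\ell^p_n\otimes X$ ($n\in\mathbb{N}$) such that 1. $\|a\otimes x\|_n=\|a\|\,\|x\|$ for $a\in\ell^p_n$, $x\in X$; 2. $\|u\|_n\ge|\langle a^*\otimes x^*,u\rangle|$ for $u\in\ell^p_n\otimes X$ and all $a^*\in(\ell^p_n)^*$, $x^*\in X^*$ of norm at most $1$; 3. $\|(T\otimes I_X)u\|_m\le\|T\|\,\|u\|_n$ for every linear $T:\ell^p_n\to\ell^p_m$ and $u\in\ell^p_n\otimes X$. For a linear map $u:X\to Y$ between $p$-multinormed spaces put $\|u\|_p=\sup_n\|I_{\ell^p_n}\otimes u:\ell^p_n\otimes X\to\ell^p_n\otimes Y\|\in[0,\infty]$; $u$ is *$p$-multibounded* if $\|u\|_p<\infty$. A linear map $q:Y\to X$ is a *$p$-quotient map* if, for every $n$, $I_{\ell^p_n}\otimes q:\ell^p_n\otimes Y\to\ell^p_n\otimes X$ is a quotient map, i.e. it is onto and $\|e\|_n=\inf\{\|y\|_n:(I_{\ell^p_n}\otimes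 q)y=e\}$ for every $e\in\ell^p_n\otimes X$. A $p$-multinormed space $Z$ is *$1$-projective* if for every $\varepsilon>0$, every $p$-quotient map $q:Y\to X$ of $p$-multinormed spaces, and every $p$-multibounded $u:Z\to X$, there is a linear $\tilde u:Z\to Y$ with $q\tilde u=u$ and $\|\tilde u\|_p\le\|u\|_p+\varepsilon$. For a Banach space $E$, $\min_p(E)$ is $E$ with $\ell^p_n\otimes E$ carrying the injective tensor norm, for every $n$. The $\ell^1$-sum $\big(\sum_{i\in I}X_i\big)_1$ of $p$-multinormed spaces is the $\ell^1$-sum of the underlying Banach spaces with the norms $\|x\|_n=\sum_{i\in I}\|x_i\|_n$, where $x_i\in\ell^p_n\otimes X_i$ is the $i$-th component of $x$. **Corollary.** For every family $(n_i)_{i\in I}$ of non-negative integers, the $p$-multinormed space $$\Big(\sum_{i\in I}\min\nolimits_p\big(\ell^{p'}_{n_i}\big)\Big)_1$$ is $1$-projective. -/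

import Mathlib

open scoped TensorProduct ENNReal

universe u v w

/-- The space `ℓ^p_n` over the reals. -/
abbrev FinLp (p : ℝ≥0∞) (n : ℕ) : Type := PiLp p (fun _ : Fin n => ℝ)

section Pairing

variable {E : Type*} {X : Type*} [NormedAddCommGroup E] [NormedSpace ℝ E]
  [NormedAddCommGroup X] [NormedSpace ℝ X]

/-- The functional `u ↦ ⟨a ⊗ f, u⟩` on `E ⊗ X`, for `a ∈ E*` and `f ∈ X*`. -/
noncomputable def tensorPairing (a : StrongDual ℝ E) (f : StrongDual ℝ X) : E ⊗[ℝ] X →ₗ[ℝ] ℝ :=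
  TensorProduct.dualDistrib ℝ E X (a.toLinearMap ⊗ₜ[ℝ] f.toLinearMap)

@[simp]
theorem tensorPairing_tmul (a : StrongDual ℝ E) (f : StrongDual ℝ X) (e : E) (x : X) :
    tensorPairing a f (e ⊗ₜ[ℝ] x) = a e * f x := by
  simp [tensorPairing]

theorem tensorPairing_bound (u : E ⊗[ℝ] X) :
    ∃ C : ℝ, ∀ (a : StrongDual ℝ E) (f : StrongDual ℝ X), ‖a‖ ≤ 1 → ‖f‖ ≤ 1 →
      |tensorPairing a f u| ≤ C := by
  induction u with
  | zero => exact ⟨0, fun a f _ _ => by simp⟩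
  | tmul e x =>
    refine ⟨‖e‖ * ‖x‖, fun a f ha hf => ?_⟩
    rw [tensorPairing_tmul, abs_mul]
    have h1 : |a e| ≤ ‖e‖ := by simpa using a.le_of_opNorm_le ha e
    have h2 : |f x| ≤ ‖x‖ := by simpa using f.le_of_opNorm_le hf x
    gcongr
  | add s t hs ht =>
    obtain ⟨C, hC⟩ := hs
    obtain ⟨D, hD⟩ := ht
    refine ⟨C + D, fun a f ha hf => ?_⟩
    rw [map_add]
    exact (abs_add_le _ _).trans (add_le_add (hC a f ha hf) (hD a f ha hf))

end Pairing

theorem eq_zero_of_tensorPairing {p : ℝ≥0∞} [Fact (1 ≤ p)] {X : Type*} [NormedAddCommGroup X]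
    [NormedSpace ℝ X] {n : ℕ} (u : FinLp p n ⊗[ℝ] X)
    (h : ∀ (a : StrongDual ℝ (FinLp p n)) (f : StrongDual ℝ X), ‖a‖ ≤ 1 → ‖f‖ ≤ 1 →
      tensorPairing a f u = 0) : u = 0 := by
  obtain ⟨b, rfl⟩ := TensorProduct.eq_repr_basis_left (PiLp.basisFun p ℝ (Fin n)) u
  suffices hb : b = 0 by simp [hb]
  ext j
  obtain ⟨f, hf, hfx⟩ := exists_dual_vector'' ℝ (b j)
  have hproj : ‖(PiLp.proj p (fun _ : Fin n => ℝ) j : StrongDual ℝ (FinLp p n))‖ ≤ 1 := by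
    refine ContinuousLinearMap.opNorm_le_bound _ zero_le_one fun x => ?_
    simpa using PiLp.norm_apply_le x j
  have := h (PiLp.proj p (fun _ : Fin n => ℝ) j) f hproj hf
  rw [Finsupp.sum_fintype _ _ (by simp)] at this
  simp only [map_sum, tensorPairing_tmul, PiLp.basisFun_apply, PiLp.proj_apply,
    PiLp.single_apply] at this
  simpa [hfx] using this

/-- A `p`-multinorm structure on a (real) Banach space `X`: norms on the spaces `ℓ^p_n ⊗ X`,
`n ∈ ℕ`, which are cross-norms and which are compatible with the action of operators
`ℓ^p_n → ℓ^p_m` on the left tensor factor. -/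
structure PMultinorm (p : ℝ≥0∞) [Fact (1 ≤ p)] (X : Type*) [NormedAddCommGroup X]
    [NormedSpace ℝ X] [CompleteSpace X] where
  /-- the norm `‖·‖_n` on `ℓ^p_n ⊗ X` -/
  norm : ∀ n : ℕ, Seminorm ℝ (FinLp p n ⊗[ℝ] X)
  eq_zero_of_norm_eq_zero : ∀ (n : ℕ) (u : FinLp p n ⊗[ℝ] X), norm n u = 0 → u = 0
  norm_tmul : ∀ (n : ℕ) (a : FinLp p n) (x : X), norm n (a ⊗ₜ[ℝ] x) = ‖a‖ * ‖x‖
  abs_pairing_le : ∀ (n : ℕ) (a : StrongDual ℝ (FinLp p n)) (f : StrongDual ℝ X),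
    ‖a‖ ≤ 1 → ‖f‖ ≤ 1 → ∀ u : FinLp p n ⊗[ℝ] X, |tensorPairing a f u| ≤ norm n u
  norm_rTensor_le : ∀ (n m : ℕ) (T : FinLp p n →L[ℝ] FinLp p m) (u : FinLp p n ⊗[ℝ] X),
    norm m (T.toLinearMap.rTensor X u) ≤ ‖T‖ * norm n u

/-- The injective tensor seminorm on `E ⊗ X`:
`‖u‖ = sup {|⟨a ⊗ f, u⟩| : a ∈ E*, f ∈ X*, ‖a‖ ≤ 1, ‖f‖ ≤ 1}`. -/
noncomputable def injectiveTensorSeminorm (E X : Type*) [NormedAddCommGroup E] [NormedSpace ℝ E]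
    [NormedAddCommGroup X] [NormedSpace ℝ X] : Seminorm ℝ (E ⊗[ℝ] X) :=
  Seminorm.of
    (fun u => ⨆ g : {g : StrongDual ℝ E × StrongDual ℝ X // ‖g.1‖ ≤ 1 ∧ ‖g.2‖ ≤ 1},
      |tensorPairing g.1.1 g.1.2 u|)
    (by
      intro s t
      have : Nonempty {g : StrongDual ℝ E × StrongDual ℝ X // ‖g.1‖ ≤ 1 ∧ ‖g.2‖ ≤ 1} :=
        ⟨⟨(0, 0), by simp⟩⟩
      obtain ⟨C, hC⟩ := tensorPairing_bound s
      obtain ⟨D, hD⟩ := tensorPairing_bound t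
      refine ciSup_le fun g => ?_
      rw [map_add]
      refine (abs_add_le _ _).trans (add_le_add ?_ ?_)
      · exact le_ciSup (f := fun g : {g : StrongDual ℝ E × StrongDual ℝ X //
          ‖g.1‖ ≤ 1 ∧ ‖g.2‖ ≤ 1} => |tensorPairing g.1.1 g.1.2 s|)
          ⟨C, by rintro _ ⟨g, rfl⟩; exact hC _ _ g.2.1 g.2.2⟩ g
      · exact le_ciSup (f := fun g : {g : StrongDual ℝ E × StrongDual ℝ X //
          ‖g.1‖ ≤ 1 ∧ ‖g.2‖ ≤ 1} => |tensorPairing g.1.1 g.1.2 t|)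
          ⟨D, by rintro _ ⟨g, rfl⟩; exact hD _ _ g.2.1 g.2.2⟩ g)
    (by
      intro c s
      simp only [map_smul, smul_eq_mul, abs_mul, Real.norm_eq_abs]
      exact (Real.mul_iSup_of_nonneg (abs_nonneg c) _).symm)

section Injective

variable {E : Type*} {X : Type*} [NormedAddCommGroup E] [NormedSpace ℝ E]
  [NormedAddCommGroup X] [NormedSpace ℝ X]

theorem injectiveTensorSeminorm_apply (u : E ⊗[ℝ] X) :
    injectiveTensorSeminorm E X u =
      ⨆ g : {g : StrongDual ℝ E × StrongDual ℝ X // ‖g.1‖ ≤ 1 ∧ ‖g.2‖ ≤ 1},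
        |tensorPairing g.1.1 g.1.2 u| := rfl

theorem abs_tensorPairing_le_injective (a : StrongDual ℝ E) (f : StrongDual ℝ X)
    (ha : ‖a‖ ≤ 1) (hf : ‖f‖ ≤ 1) (u : E ⊗[ℝ] X) :
    |tensorPairing a f u| ≤ injectiveTensorSeminorm E X u := by
  obtain ⟨C, hC⟩ := tensorPairing_bound u
  exact le_ciSup (f := fun g : {g : StrongDual ℝ E × StrongDual ℝ X //
    ‖g.1‖ ≤ 1 ∧ ‖g.2‖ ≤ 1} => |tensorPairing g.1.1 g.1.2 u|)
    ⟨C, by rintro _ ⟨g, rfl⟩; exact hC _ _ g.2.1 g.2.2⟩ ⟨(a, f), ha, hf⟩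

theorem injectiveTensorSeminorm_le {u : E ⊗[ℝ] X} {C : ℝ}
    (h : ∀ (a : StrongDual ℝ E) (f : StrongDual ℝ X), ‖a‖ ≤ 1 → ‖f‖ ≤ 1 →
      |tensorPairing a f u| ≤ C) : injectiveTensorSeminorm E X u ≤ C := by
  have : Nonempty {g : StrongDual ℝ E × StrongDual ℝ X // ‖g.1‖ ≤ 1 ∧ ‖g.2‖ ≤ 1} :=
    ⟨⟨(0, 0), by simp⟩⟩
  exact ciSup_le fun g => h _ _ g.2.1 g.2.2

theorem injectiveTensorSeminorm_tmul (e : E) (x : X) :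
    injectiveTensorSeminorm E X (e ⊗ₜ[ℝ] x) = ‖e‖ * ‖x‖ := by
  apply le_antisymm
  · refine injectiveTensorSeminorm_le fun a f ha hf => ?_
    rw [tensorPairing_tmul, abs_mul]
    have h1 : |a e| ≤ ‖e‖ := by simpa using a.le_of_opNorm_le ha e
    have h2 : |f x| ≤ ‖x‖ := by simpa using f.le_of_opNorm_le hf x
    gcongr
  · obtain ⟨a, ha, hae⟩ := exists_dual_vector'' ℝ e
    obtain ⟨f, hf, hfx⟩ := exists_dual_vector'' ℝ x
    have := abs_tensorPairing_le_injective a f ha hf (e ⊗ₜ[ℝ] x)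
    rw [tensorPairing_tmul, abs_mul, hae, hfx] at this
    simpa using this

theorem tensorPairing_rTensor {F : Type*} [NormedAddCommGroup F] [NormedSpace ℝ F]
    (T : E →L[ℝ] F) (a : StrongDual ℝ F) (f : StrongDual ℝ X) (u : E ⊗[ℝ] X) :
    tensorPairing a f (T.toLinearMap.rTensor X u) = tensorPairing (a.comp T) f u := by
  induction u with
  | zero => simp
  | tmul e x => simp
  | add s t hs ht => simp only [map_add, hs, ht]

theorem tensorPairing_smul_left (c : ℝ) (a : StrongDual ℝ E) (f : StrongDual ℝ X)
    (u : E ⊗[ℝ] X) : tensorPairing (c • a) f u = c * tensorPairing a f u := by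
  induction u with
  | zero => simp
  | tmul e x => simp [mul_assoc]
  | add s t hs ht => simp only [map_add, hs, ht, mul_add]

theorem injectiveTensorSeminorm_rTensor_le {F : Type*} [NormedAddCommGroup F] [NormedSpace ℝ F]
    (T : E →L[ℝ] F) (u : E ⊗[ℝ] X) :
    injectiveTensorSeminorm F X (T.toLinearMap.rTensor X u)
      ≤ ‖T‖ * injectiveTensorSeminorm E X u := by
  refine injectiveTensorSeminorm_le fun a f ha hf => ?_
  rw [tensorPairing_rTensor]
  rcases eq_or_ne ‖T‖ 0 with h0 | h0
  · have : T = 0 := norm_eq_zero.mp h0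
    subst this
    have h2 := tensorPairing_smul_left 0 (0 : StrongDual ℝ E) f u
    rw [ContinuousLinearMap.comp_zero]
    simp only [smul_zero, zero_mul] at h2
    simp [h2]
  · have h1 : a.comp T = ‖T‖ • (‖T‖⁻¹ • a.comp T) := by
      rw [smul_smul, mul_inv_cancel₀ h0, one_smul]
    rw [h1, tensorPairing_smul_left, abs_mul, abs_norm]
    refine mul_le_mul_of_nonneg_left
      (abs_tensorPairing_le_injective _ _ ?_ hf u) (norm_nonneg _)
    rw [norm_smul, norm_inv, norm_norm, inv_mul_le_iff₀ (by positivity), mul_one]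
    calc ‖a.comp T‖ ≤ ‖a‖ * ‖T‖ := a.opNorm_comp_le T
      _ ≤ 1 * ‖T‖ := by gcongr
      _ = ‖T‖ := one_mul _

end Injective

namespace PMultinorm

/-- The minimal `p`-multinorm structure `min_p(E)` on a Banach space `E`: the norm on
`ℓ^p_n ⊗ E` is the injective tensor norm. -/
noncomputable def min (p : ℝ≥0∞) [Fact (1 ≤ p)] (E : Type*) [NormedAddCommGroup E]
    [NormedSpace ℝ E] [CompleteSpace E] : PMultinorm p E where
  norm n := injectiveTensorSeminorm (FinLp p n) E
  eq_zero_of_norm_eq_zero _ u hu := eq_zero_of_tensorPairing u fun a f ha hf =>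
    abs_eq_zero.mp (le_antisymm (hu ▸ abs_tensorPairing_le_injective a f ha hf u) (abs_nonneg _))
  norm_tmul _ a x := injectiveTensorSeminorm_tmul a x
  abs_pairing_le _ a f ha hf u := abs_tensorPairing_le_injective a f ha hf u
  norm_rTensor_le _ _ T u := injectiveTensorSeminorm_rTensor_le T u

section Sum

variable {p : ℝ≥0∞} [Fact (1 ≤ p)] {I : Type*} {X : I → Type*} [∀ i, NormedAddCommGroup (X i)]
  [∀ i, NormedSpace ℝ (X i)] [∀ i, CompleteSpace (X i)]

/-- The component in `ℓ^p_n ⊗ X i` of an element of `ℓ^p_n ⊗ (∑ i, X i)_1`. -/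
noncomputable def component (p : ℝ≥0∞) (X : I → Type*) [∀ i, NormedAddCommGroup (X i)]
    [∀ i, NormedSpace ℝ (X i)] (n : ℕ) (i : I) :
    FinLp p n ⊗[ℝ] lp X 1 →ₗ[ℝ] FinLp p n ⊗[ℝ] X i :=
  (lp.evalCLM ℝ X 1 i).toLinearMap.lTensor (FinLp p n)

@[simp]
theorem component_tmul (n : ℕ) (i : I) (a : FinLp p n) (x : lp X 1) :
    component p X n i (a ⊗ₜ[ℝ] x) = a ⊗ₜ[ℝ] (x i) := rfl

theorem hasSum_norm_lp_one (x : lp X 1) : HasSum (fun i => ‖x i‖) ‖x‖ := by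
  simpa using lp.hasSum_norm (p := 1) (by simp) x

theorem summable_component (N : ∀ i, PMultinorm p (X i)) (n : ℕ) (u : FinLp p n ⊗[ℝ] lp X 1) :
    Summable fun i => (N i).norm n (component p X n i u) := by
  induction u with
  | zero => simp
  | tmul a x =>
    simp only [component_tmul, norm_tmul]
    exact (hasSum_norm_lp_one x).summable.mul_left _
  | add s t hs ht =>
    refine Summable.of_nonneg_of_le (fun i => apply_nonneg _ _) (fun i => ?_) (hs.add ht)
    rw [map_add]
    exact map_add_le_add _ _ _

/-- The norm `‖x‖ = ∑ i, ‖x_i‖` on `ℓ^p_n ⊗ (∑ i, X i)_1`. -/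
noncomputable def l1SumSeminorm (N : ∀ i, PMultinorm p (X i)) (n : ℕ) :
    Seminorm ℝ (FinLp p n ⊗[ℝ] lp X 1) :=
  Seminorm.of (fun u => ∑' i, (N i).norm n (component p X n i u))
    (by
      intro s t
      rw [← (summable_component N n s).tsum_add (summable_component N n t)]
      refine (summable_component N n (s + t)).tsum_le_tsum (fun i => ?_)
        ((summable_component N n s).add (summable_component N n t))
      rw [map_add]
      exact map_add_le_add _ _ _)
    (by
      intro c s
      simp only [map_smul, map_smul_eq_mul]
      exact tsum_mul_left)

theorem l1SumSeminorm_apply (N : ∀ i, PMultinorm p (X i)) (n : ℕ) (u : FinLp p n ⊗[ℝ] lp X 1) :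
    l1SumSeminorm N n u = ∑' i, (N i).norm n (component p X n i u) := rfl

theorem l1SumSeminorm_tmul (N : ∀ i, PMultinorm p (X i)) (n : ℕ) (a : FinLp p n) (x : lp X 1) :
    l1SumSeminorm N n (a ⊗ₜ[ℝ] x) = ‖a‖ * ‖x‖ := by
  simp only [l1SumSeminorm_apply, component_tmul, norm_tmul]
  rw [tsum_mul_left, (hasSum_norm_lp_one x).tsum_eq]

theorem component_rTensor {n m : ℕ} (T : FinLp p n →L[ℝ] FinLp p m) (i : I)
    (u : FinLp p n ⊗[ℝ] lp X 1) :
    component p X m i (T.toLinearMap.rTensor (lp X 1) u) =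
      T.toLinearMap.rTensor (X i) (component p X n i u) := by
  induction u with
  | zero => simp
  | tmul a x => simp
  | add s t hs ht => simp only [map_add, hs, ht]

theorem l1SumSeminorm_rTensor_le (N : ∀ i, PMultinorm p (X i)) (n m : ℕ)
    (T : FinLp p n →L[ℝ] FinLp p m) (u : FinLp p n ⊗[ℝ] lp X 1) :
    l1SumSeminorm N m (T.toLinearMap.rTensor (lp X 1) u) ≤ ‖T‖ * l1SumSeminorm N n u := by
  simp only [l1SumSeminorm_apply]
  rw [← tsum_mul_left]
  refine (summable_component N m _).tsum_le_tsum (fun i => ?_)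
    ((summable_component N n u).mul_left _)
  rw [component_rTensor]
  exact (N i).norm_rTensor_le n m T _

end Sum

/-- For a sequence of seminorms, the lower bound in the definition of a cross-norm follows from the
remaining conditions. -/
theorem abs_pairing_le_of_rTensor_le {p : ℝ≥0∞} [Fact (1 ≤ p)] {X : Type*} [NormedAddCommGroup X]
    [NormedSpace ℝ X] (N : ∀ n : ℕ, Seminorm ℝ (FinLp p n ⊗[ℝ] X))
    (h1 : ∀ (n : ℕ) (a : FinLp p n) (x : X), N n (a ⊗ₜ[ℝ] x) = ‖a‖ * ‖x‖)
    (h2 : ∀ (n m : ℕ) (T : FinLp p n →L[ℝ] FinLp p m) (u : FinLp p n ⊗[ℝ] X),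
      N m (T.toLinearMap.rTensor X u) ≤ ‖T‖ * N n u)
    (n : ℕ) (a : StrongDual ℝ (FinLp p n)) (f : StrongDual ℝ X) (ha : ‖a‖ ≤ 1) (hf : ‖f‖ ≤ 1)
    (u : FinLp p n ⊗[ℝ] X) : |tensorPairing a f u| ≤ N n u := by
  let d : FinLp p 1 := PiLp.single p 0 1
  have hd : ‖d‖ = 1 := by simp [d, PiLp.norm_single]
  let T : FinLp p n →L[ℝ] FinLp p 1 := a.smulRight d
  have hT : ‖T‖ ≤ 1 := by
    rw [ContinuousLinearMap.norm_smulRight_apply, hd, mul_one]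
    exact ha
  have key : ∃ y : X, T.toLinearMap.rTensor X u = d ⊗ₜ[ℝ] y ∧ f y = tensorPairing a f u := by
    induction u with
    | zero => exact ⟨0, by simp⟩
    | tmul e x => exact ⟨a e • x, by simp [T, TensorProduct.smul_tmul], by simp⟩
    | add s t hs ht =>
      obtain ⟨y, hy, hy'⟩ := hs
      obtain ⟨z, hz, hz'⟩ := ht
      exact ⟨y + z, by simp only [map_add, hy, hz, TensorProduct.tmul_add], by
        simp only [map_add, hy', hz']⟩
  obtain ⟨y, hy, hy'⟩ := key
  have h3 := h2 n 1 T u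
  rw [hy, h1, hd, one_mul] at h3
  calc |tensorPairing a f u| = ‖f y‖ := by rw [hy', Real.norm_eq_abs]
    _ ≤ ‖y‖ := by simpa using f.le_of_opNorm_le hf y
    _ ≤ ‖T‖ * N n u := h3
    _ ≤ 1 * N n u := by gcongr
    _ = N n u := one_mul _

/-- The `ℓ^1`-sum of a family of `p`-multinormed spaces. The underlying Banach space is the
`ℓ^1`-sum of the underlying Banach spaces, and `‖x‖_n = ∑ i, ‖x_i‖_n` for
`x ∈ ℓ^p_n ⊗ (∑ i, X i)_1` with components `x_i ∈ ℓ^p_n ⊗ X i`. -/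
noncomputable def l1Sum {p : ℝ≥0∞} [Fact (1 ≤ p)] {I : Type*} {X : I → Type*}
    [∀ i, NormedAddCommGroup (X i)] [∀ i, NormedSpace ℝ (X i)] [∀ i, CompleteSpace (X i)]
    (N : ∀ i, PMultinorm p (X i)) : PMultinorm p (lp X 1) where
  norm n := l1SumSeminorm N n
  eq_zero_of_norm_eq_zero n u hu := eq_zero_of_tensorPairing u fun a f ha hf =>
    abs_eq_zero.mp (le_antisymm (hu ▸ abs_pairing_le_of_rTensor_le _ (l1SumSeminorm_tmul N)
      (l1SumSeminorm_rTensor_le N) n a f ha hf u) (abs_nonneg _))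
  norm_tmul n a x := l1SumSeminorm_tmul N n a x
  abs_pairing_le n a f ha hf u := abs_pairing_le_of_rTensor_le _ (l1SumSeminorm_tmul N)
    (l1SumSeminorm_rTensor_le N) n a f ha hf u
  norm_rTensor_le n m T u := l1SumSeminorm_rTensor_le N n m T u

section Maps

variable {p : ℝ≥0∞} [Fact (1 ≤ p)] {X Y : Type*}
  [NormedAddCommGroup X] [NormedSpace ℝ X] [CompleteSpace X]
  [NormedAddCommGroup Y] [NormedSpace ℝ Y] [CompleteSpace Y]

/-- The `p`-norm `‖T‖_p = sup_n ‖I ⊗ T : ℓ^p_n ⊗ X → ℓ^p_n ⊗ Y‖` of a linear map `T : X → Y`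
between `p`-multinormed spaces, as an element of `[0, ∞]`. -/
noncomputable def pNorm (NX : PMultinorm p X) (NY : PMultinorm p Y) (T : X →ₗ[ℝ] Y) : ℝ≥0∞ :=
  ⨆ (n : ℕ) (x : FinLp p n ⊗[ℝ] X) (_ : NX.norm n x ≤ 1),
    ENNReal.ofReal (NY.norm n (T.lTensor (FinLp p n) x))

/-- A linear map is `p`-multibounded if its `p`-norm is finite. -/
def IsMultibounded (NX : PMultinorm p X) (NY : PMultinorm p Y) (T : X →ₗ[ℝ] Y) : Prop :=
  pNorm NX NY T < ∞

/-- `q : Y → X` is a `p`-quotient map if, for every `n`, `I ⊗ q : ℓ^p_n ⊗ Y → ℓ^p_n ⊗ X` is a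
quotient map of normed spaces: it is onto, and the norm of `e ∈ ℓ^p_n ⊗ X` is the infimum of the
norms of its preimages. -/
def IsPQuotientMap (NY : PMultinorm p Y) (NX : PMultinorm p X) (q : Y →ₗ[ℝ] X) : Prop :=
  ∀ n : ℕ, Function.Surjective (q.lTensor (FinLp p n)) ∧
    ∀ e : FinLp p n ⊗[ℝ] X,
      IsGLB {r : ℝ | ∃ y : FinLp p n ⊗[ℝ] Y, q.lTensor (FinLp p n) y = e ∧ NY.norm n y = r}
        (NX.norm n e)

end Maps

/-- A `p`-multinormed space `Z` is `1`-projective if, for every `ε > 0`, every `p`-quotient map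
`q : Y → X` of `p`-multinormed spaces and every `p`-multibounded `u : Z → X`, there is a lifting
`U : Z → Y` with `q ∘ U = u` and `‖U‖_p ≤ ‖u‖_p + ε`. -/
def IsOneProjective {p : ℝ≥0∞} [Fact (1 ≤ p)] {Z : Type u} [NormedAddCommGroup Z]
    [NormedSpace ℝ Z] [CompleteSpace Z] (NZ : PMultinorm p Z) : Prop :=
  ∀ ε : ℝ, 0 < ε →
    ∀ (Y : Type v) [NormedAddCommGroup Y] [NormedSpace ℝ Y] [CompleteSpace Y]
      (NY : PMultinorm p Y)
      (X : Type w) [NormedAddCommGroup X] [NormedSpace ℝ X] [CompleteSpace X]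
      (NX : PMultinorm p X)
      (q : Y →ₗ[ℝ] X), IsPQuotientMap NY NX q →
      ∀ u : Z →ₗ[ℝ] X, IsMultibounded NZ NX u →
        ∃ U : Z →ₗ[ℝ] Y, q ∘ₗ U = u ∧
          pNorm NZ NY U ≤ pNorm NZ NX u + ENNReal.ofReal ε

end PMultinorm

/-! A linear map T from ℓ^{p'}_k to X is the same thing as a tensor t in ℓ^p_k ⊗ X, and the p-norm
of T on min_p(ℓ^{p'}_k) is exactly ‖t‖_k. For the upper bound, x in ℓ^p_m ⊗ ℓ^{p'}_k acts as an
operator S : ℓ^p_k → ℓ^p_m with ‖S‖ at most the injective norm of x, and (I ⊗ T)x = (S ⊗ I)t, so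
axiom 3 applies (`norm_lTensor_le_norm_mapTensor`). For the lower bound, t is the image under I ⊗ T
of the identity tensor, whose injective norm is at most 1 (`norm_mapTensor_le`).

Lifting T along q with small loss of norm is therefore lifting t, which is the quotient property at
level k (`exists_lift_min`). On an ℓ^1-sum, the restrictions of u to the summands are lifted with
one common bound ‖u‖_p + ε. These lifts sum to a map on the whole space, and the bound survives at
every level by approximation with finite partial sums (`norm_lTensor_le_of_hasSum`). -/

/-! ### Linear maps on ℓ^{p'}_n as tensors in ℓ^p_n ⊗ X -/

section MapTensor

variable {p p' : ℝ≥0∞} {n : ℕ}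

/-- The tensor in `ℓ^p_n ⊗ X` which represents a linear map `ℓ^{p'}_n → X`. -/
noncomputable def mapTensor (p : ℝ≥0∞) {p' : ℝ≥0∞} {n : ℕ} {X : Type*} [AddCommGroup X]
    [Module ℝ X] (T : FinLp p' n →ₗ[ℝ] X) : FinLp p n ⊗[ℝ] X :=
  ∑ j, PiLp.single p j (1 : ℝ) ⊗ₜ[ℝ] T (PiLp.single p' j 1)

theorem lTensor_mapTensor {X Y : Type*} [AddCommGroup X] [Module ℝ X] [AddCommGroup Y] [Module ℝ Y]
    (T : FinLp p' n →ₗ[ℝ] X) (S : X →ₗ[ℝ] Y) :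
    S.lTensor (FinLp p n) (mapTensor p T) = mapTensor p (S ∘ₗ T) := by
  simp [mapTensor]

theorem exists_mapTensor_eq {X : Type*} [AddCommGroup X] [Module ℝ X] (t : FinLp p n ⊗[ℝ] X) :
    ∃ T : FinLp p' n →ₗ[ℝ] X, mapTensor p T = t := by
  obtain ⟨b, rfl⟩ := TensorProduct.eq_repr_basis_left (PiLp.basisFun p ℝ (Fin n)) t
  refine ⟨(PiLp.basisFun p' ℝ (Fin n)).constr ℝ b, ?_⟩
  rw [Finsupp.sum_fintype _ _ (by simp)]
  refine Finset.sum_congr rfl fun j _ => ?_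
  rw [← PiLp.basisFun_apply p', Module.Basis.constr_basis, PiLp.basisFun_apply]

theorem mapTensor_injective {X : Type*} [AddCommGroup X] [Module ℝ X] :
    Function.Injective (mapTensor p : (FinLp p' n →ₗ[ℝ] X) → FinLp p n ⊗[ℝ] X) := by
  intro T S h
  refine (PiLp.basisFun p' ℝ (Fin n)).ext fun i => ?_
  -- Applying the i-th coordinate functional to the left factor recovers the value of the map at the
  -- i-th basis vector.
  have h2 := congrArg (fun t => TensorProduct.lid ℝ X
    ((PiLp.projₗ p (𝕜 := ℝ) (fun _ : Fin n => ℝ) i).rTensor X t)) h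
  simpa [mapTensor, PiLp.single_apply] using h2

end MapTensor

/-! ### Duality of ℓ^p_n and ℓ^{p'}_n, and the injective norm -/

section Duality

variable {p p' : ℝ≥0∞} [Fact (1 ≤ p)] [Fact (1 ≤ p')] {n : ℕ}

/-- Hölder's inequality for `ℓ^p_n` and `ℓ^{p'}_n`. -/
theorem PiLp.abs_sum_mul_le [p.HolderConjugate p'] (a : FinLp p n) (b : FinLp p' n) :
    |∑ j, a j * b j| ≤ ‖a‖ * ‖b‖ := by
  refine (Finset.abs_sum_le_sum_abs _ _).trans ?_
  simp only [abs_mul]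
  have hconj : p⁻¹ + p'⁻¹ = 1 := ENNReal.HolderConjugate.inv_add_inv_eq_one p p'
  rcases eq_or_ne p ∞ with rfl | hp
  · have : p' = 1 := by simpa using hconj
    subst this
    rw [PiLp.norm_eq_of_L1 b, Finset.mul_sum]
    gcongr with j
    · exact PiLp.norm_apply_le a j
    · exact le_rfl
  rcases eq_or_ne p' ∞ with rfl | hq
  · have : p = 1 := by simpa using hconj
    subst this
    rw [PiLp.norm_eq_of_L1 a, Finset.sum_mul]
    gcongr with j
    · exact le_rfl
    · exact PiLp.norm_apply_le b j
  have hr := ENNReal.HolderConjugate.toReal_of_ne_top hp hq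
  rw [PiLp.norm_eq_sum hr.pos, PiLp.norm_eq_sum hr.symm.pos]
  simpa using Real.inner_le_Lp_mul_Lq Finset.univ (fun j => |a j|) (fun j => |b j|) hr

/-- The norm of `ℓ^p_n` is attained on the unit ball of `ℓ^{p'}_n`. -/
theorem PiLp.exists_sum_mul_eq_norm [p.HolderConjugate p'] (a : FinLp p n) :
    ∃ b : FinLp p' n, ‖b‖ ≤ 1 ∧ ∑ j, a j * b j = ‖a‖ := by
  have hconj : p⁻¹ + p'⁻¹ = 1 := ENNReal.HolderConjugate.inv_add_inv_eq_one p p'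
  rcases eq_or_ne p ∞ with rfl | hp
  · rcases isEmpty_or_nonempty (Fin n) with h | h
    · exact ⟨0, by simp, by simp [Subsingleton.elim a 0]⟩
    obtain ⟨j, hj⟩ := exists_eq_ciSup_of_finite (f := fun i => ‖a i‖)
    -- For p = ∞ the extremiser is a signed basis vector at a coordinate where |a| is maximal.
    refine ⟨PiLp.single p' j (SignType.sign (a j) : ℝ), ?_, ?_⟩
    · rw [PiLp.norm_single]
      rcases lt_trichotomy (a j) 0 with h | h | h <;> simp [h]
    · rw [PiLp.norm_eq_ciSup, ← hj]
      simp [PiLp.single_apply]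
  rcases eq_or_ne p' ∞ with rfl | hq
  · have : p = 1 := by simpa using hconj
    subst this
    refine ⟨WithLp.toLp ∞ fun j => (SignType.sign (a j) : ℝ), ?_, ?_⟩
    · rw [PiLp.norm_toLp, pi_norm_le_iff_of_nonneg zero_le_one]
      intro j
      rcases lt_trichotomy (a j) 0 with h | h | h <;> simp [h]
    · rw [PiLp.norm_eq_of_L1]
      simp
  have hr := ENNReal.HolderConjugate.toReal_of_ne_top hp hq
  -- The equality case of Hölder gives a nonnegative extremiser for |a|; multiplying by the signs of
  -- a adapts it to a.
  obtain ⟨g, hg, hga⟩ := (NNReal.isGreatest_Lp Finset.univ (fun j => ‖a j‖₊) hr).1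
  refine ⟨WithLp.toLp p' fun j => (SignType.sign (a j) : ℝ) * g j, ?_, ?_⟩
  · rw [PiLp.norm_eq_sum hr.symm.pos]
    refine Real.rpow_le_one (by positivity) ?_ (by have := hr.symm.pos; positivity)
    calc ∑ j, ‖(SignType.sign (a j) : ℝ) * g j‖ ^ p'.toReal
        ≤ ∑ j, (g j : ℝ) ^ p'.toReal := by
          refine Finset.sum_le_sum fun j _ =>
            Real.rpow_le_rpow (norm_nonneg _) ?_ hr.symm.nonneg
          rcases lt_trichotomy (a j) 0 with h | h | h <;> simp [h]
      _ ≤ 1 := by exact_mod_cast hg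
  · rw [PiLp.norm_eq_sum hr.pos]
    have h2 := congrArg NNReal.toReal hga
    push_cast at h2
    rw [← h2]
    refine Finset.sum_congr rfl fun j _ => ?_
    simp [← mul_assoc]

/-- The functional on `ℓ^{p'}_n` given by an element of `ℓ^p_n`. -/
theorem PiLp.exists_dual_eq_sum_mul [p.HolderConjugate p'] (a : FinLp p n) :
    ∃ f : StrongDual ℝ (FinLp p' n), ‖f‖ ≤ ‖a‖ ∧ ∀ b, f b = ∑ j, a j * b j :=
  ⟨LinearMap.mkContinuous
    { toFun := fun b => ∑ j, a j * b j
      map_add' := fun b c => by simp [mul_add, Finset.sum_add_distrib]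
      map_smul' := fun r b => by simp [Finset.mul_sum, mul_left_comm] } ‖a‖
    fun b => PiLp.abs_sum_mul_le a b, LinearMap.mkContinuous_norm_le _ (norm_nonneg _) _,
    fun _ => rfl⟩

/-- A functional on `ℓ^{p'}_n`, as an element of `ℓ^p_n`. -/
theorem PiLp.norm_toLp_dual_le [p.HolderConjugate p'] (f : StrongDual ℝ (FinLp p' n)) :
    ‖(WithLp.toLp p fun j => f (PiLp.single p' j 1) : FinLp p n)‖ ≤ ‖f‖ := by
  obtain ⟨b, hb, hab⟩ := PiLp.exists_sum_mul_eq_norm (p' := p')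
    (WithLp.toLp p fun j => f (PiLp.single p' j 1) : FinLp p n)
  rw [← hab]
  have hfb : ∑ j, f (PiLp.single p' j 1) * b j = f b := by
    conv_rhs => rw [← (PiLp.basisFun p' ℝ (Fin n)).sum_repr b]
    simp [mul_comm]
  calc ∑ j, f (PiLp.single p' j 1) * b j = f b := hfb
    _ ≤ ‖f b‖ := le_abs_self _
    _ ≤ ‖f‖ * ‖b‖ := f.le_opNorm b
    _ ≤ ‖f‖ := mul_le_of_le_one_right (norm_nonneg _) hb

/-- Pairing the identity tensor with a ⊗ f evaluates a at f, where f is regarded as a vector of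
ℓ^p_n of norm at most ‖f‖. -/
theorem injectiveTensorSeminorm_mapTensor_id_le [p.HolderConjugate p'] :
    injectiveTensorSeminorm (FinLp p n) (FinLp p' n) (mapTensor p LinearMap.id) ≤ 1 := by
  refine injectiveTensorSeminorm_le fun a f ha hf => ?_
  have h : tensorPairing a f (mapTensor p LinearMap.id) =
      a (WithLp.toLp p fun j => f (PiLp.single p' j 1)) := by
    conv_rhs => rw [← (PiLp.basisFun p ℝ (Fin n)).sum_repr
      (WithLp.toLp p fun j => f (PiLp.single p' j 1))]
    simp [mapTensor, mul_comm]
  rw [h, ← Real.norm_eq_abs]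
  calc _ ≤ ‖a‖ * ‖(WithLp.toLp p fun j => f (PiLp.single p' j 1) : FinLp p n)‖ := a.le_opNorm _
    _ ≤ 1 * 1 := by
      gcongr
      exact (PiLp.norm_toLp_dual_le f).trans hf
    _ = 1 := one_mul 1

/-- Tensors in `ℓ^p_m ⊗ ℓ^{p'}_n` act as operators `ℓ^p_n → ℓ^p_m`, with norm at most the injective
norm. -/
theorem exists_rTensor_mapTensor_eq_lTensor [p.HolderConjugate p'] {m : ℕ}
    (x : FinLp p m ⊗[ℝ] FinLp p' n) {X : Type*} [AddCommGroup X] [Module ℝ X] :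
    ∃ S : FinLp p n →L[ℝ] FinLp p m,
      ‖S‖ ≤ injectiveTensorSeminorm (FinLp p m) (FinLp p' n) x ∧
      ∀ T : FinLp p' n →ₗ[ℝ] X,
        T.lTensor (FinLp p m) x = S.toLinearMap.rTensor X (mapTensor p T) := by
  obtain ⟨z, hz⟩ := TensorProduct.eq_repr_basis_right (PiLp.basisFun p' ℝ (Fin n)) x
  rw [Finsupp.sum_fintype _ _ (by simp)] at hz
  -- With x = ∑ z_j ⊗ e_j, the operator S sends e_j to z_j.
  refine ⟨∑ j, (PiLp.proj p (fun _ : Fin n => ℝ) j : StrongDual ℝ (FinLp p n)).smulRight (z j),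
    ?_, fun T => ?_⟩
  · refine ContinuousLinearMap.opNorm_le_of_unit_norm (apply_nonneg _ _) fun a ha => ?_
    -- For a unit vector a, let f be the functional it defines and b a functional norming S a; then
    -- ⟨b ⊗ f, x⟩ = ‖S a‖.
    obtain ⟨f, hf, hfa⟩ := PiLp.exists_dual_eq_sum_mul (p' := p') a
    obtain ⟨b, hb, hba⟩ := exists_dual_vector'' ℝ (∑ j, a j • z j)
    have h := abs_tensorPairing_le_injective b f hb (hf.trans ha.le) x
    have h2 : tensorPairing b f x = b (∑ j, a j • z j) := by
      rw [← hz]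
      simp [hfa, PiLp.single_apply, mul_comm]
    rw [h2, hba] at h
    simpa using h
  · rw [← hz]
    simp only [mapTensor, map_sum, LinearMap.lTensor_tmul, LinearMap.rTensor_tmul]
    refine Finset.sum_congr rfl fun j _ => ?_
    simp [PiLp.single_apply]

end Duality

namespace PMultinorm

/-! ### Consequences of multiboundedness and of the quotient property -/

section Bounds

variable {p : ℝ≥0∞} [Fact (1 ≤ p)] {X Y : Type*}
  [NormedAddCommGroup X] [NormedSpace ℝ X] [CompleteSpace X]
  [NormedAddCommGroup Y] [NormedSpace ℝ Y] [CompleteSpace Y]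
  {NX : PMultinorm p X} {NY : PMultinorm p Y} {T : X →ₗ[ℝ] Y}

theorem pNorm_le {C : ℝ} (hC : 0 ≤ C)
    (h : ∀ n x, NY.norm n (T.lTensor (FinLp p n) x) ≤ C * NX.norm n x) :
    pNorm NX NY T ≤ ENNReal.ofReal C :=
  iSup_le fun n => iSup₂_le fun x hx =>
    ENNReal.ofReal_le_ofReal ((h n x).trans (mul_le_of_le_one_right hC hx))

theorem norm_lTensor_le (h : IsMultibounded NX NY T) (n : ℕ) (x : FinLp p n ⊗[ℝ] X) :
    NY.norm n (T.lTensor (FinLp p n) x) ≤ (pNorm NX NY T).toReal * NX.norm n x := by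
  rcases eq_or_ne (NX.norm n x) 0 with h0 | h0
  · rw [NX.eq_zero_of_norm_eq_zero n x h0]
    simp
  have hpos : 0 < NX.norm n x := lt_of_le_of_ne (apply_nonneg _ _) h0.symm
  have h1 : NX.norm n ((NX.norm n x)⁻¹ • x) ≤ 1 := by
    rw [map_smul_eq_mul, norm_inv, Real.norm_of_nonneg hpos.le, inv_mul_cancel₀ h0]
  have h2 : ENNReal.ofReal (NY.norm n (T.lTensor (FinLp p n) ((NX.norm n x)⁻¹ • x)))
      ≤ pNorm NX NY T :=
    le_iSup_of_le n (le_iSup₂_of_le (f := fun (x : FinLp p n ⊗[ℝ] X) (_ : NX.norm n x ≤ 1) =>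
      ENNReal.ofReal (NY.norm n (T.lTensor (FinLp p n) x))) _ h1 le_rfl)
  rw [ENNReal.ofReal_le_iff_le_toReal h.ne, map_smul, map_smul_eq_mul, norm_inv,
    Real.norm_of_nonneg hpos.le, inv_mul_le_iff₀ hpos] at h2
  rwa [mul_comm]

/-- Level 1 carries the Banach space norm, since the basis vector of ℓ^p_1 has norm one. This yields
ordinary continuity of multibounded maps. -/
theorem norm_apply_le {C : ℝ}
    (h : ∀ x, NY.norm 1 (T.lTensor (FinLp p 1) x) ≤ C * NX.norm 1 x) (x : X) :
    ‖T x‖ ≤ C * ‖x‖ := by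
  simpa [norm_tmul, PiLp.norm_single] using h (PiLp.single p 0 1 ⊗ₜ[ℝ] x)

theorem IsPQuotientMap.norm_lTensor_le {q : Y →ₗ[ℝ] X} (hq : IsPQuotientMap NY NX q) (n : ℕ)
    (y : FinLp p n ⊗[ℝ] Y) : NX.norm n (q.lTensor (FinLp p n) y) ≤ NY.norm n y :=
  ((hq n).2 _).1 ⟨y, rfl, rfl⟩

theorem IsPQuotientMap.exists_norm_lt {q : Y →ₗ[ℝ] X} (hq : IsPQuotientMap NY NX q) {n : ℕ}
    {e : FinLp p n ⊗[ℝ] X} {r : ℝ} (hr : NX.norm n e < r) :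
    ∃ y, q.lTensor (FinLp p n) y = e ∧ NY.norm n y < r := by
  obtain ⟨_, ⟨y, hy, rfl⟩, -, h⟩ := ((hq n).2 e).exists_between hr
  exact ⟨y, hy, h⟩

end Bounds

/-! ### Maps out of min_p(ℓ^{p'}_k) -/

section Min

variable {p p' : ℝ≥0∞} [Fact (1 ≤ p)] [Fact (1 ≤ p')] [p.HolderConjugate p'] {k : ℕ} {X : Type*}
  [NormedAddCommGroup X] [NormedSpace ℝ X] [CompleteSpace X] {NX : PMultinorm p X}

theorem norm_lTensor_le_norm_mapTensor (T : FinLp p' k →ₗ[ℝ] X) (n : ℕ)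
    (x : FinLp p n ⊗[ℝ] FinLp p' k) :
    NX.norm n (T.lTensor (FinLp p n) x) ≤
      NX.norm k (mapTensor p T) * (min p (FinLp p' k)).norm n x := by
  obtain ⟨S, hS, h⟩ := exists_rTensor_mapTensor_eq_lTensor x (X := X)
  rw [h T, mul_comm]
  exact (NX.norm_rTensor_le k n S _).trans (mul_le_mul_of_nonneg_right hS (apply_nonneg _ _))

theorem norm_mapTensor_le {T : FinLp p' k →ₗ[ℝ] X} {C : ℝ} (hC : 0 ≤ C)
    (h : ∀ x, NX.norm k (T.lTensor (FinLp p k) x) ≤ C * (min p (FinLp p' k)).norm k x) :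
    NX.norm k (mapTensor p T) ≤ C := by
  have h1 := h (mapTensor p LinearMap.id)
  rw [lTensor_mapTensor, LinearMap.comp_id] at h1
  exact h1.trans (mul_le_of_le_one_right hC injectiveTensorSeminorm_mapTensor_id_le)

/-- Lifting of maps out of `min_p(ℓ^{p'}_k)` along a `p`-quotient map. -/
theorem exists_lift_min {Y : Type*} [NormedAddCommGroup Y] [NormedSpace ℝ Y] [CompleteSpace Y]
    {NY : PMultinorm p Y} {q : Y →ₗ[ℝ] X} (hq : IsPQuotientMap NY NX q)
    {T : FinLp p' k →ₗ[ℝ] X} {C D : ℝ} (hC : 0 ≤ C) (hCD : C < D)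
    (h : ∀ x, NX.norm k (T.lTensor (FinLp p k) x) ≤ C * (min p (FinLp p' k)).norm k x) :
    ∃ U : FinLp p' k →ₗ[ℝ] Y, q ∘ₗ U = T ∧
      ∀ n x, NY.norm n (U.lTensor (FinLp p n) x) ≤ D * (min p (FinLp p' k)).norm n x := by
  -- The quotient norm is an infimum that need not be attained, hence the room between C and D.
  obtain ⟨y, hy, hyD⟩ := hq.exists_norm_lt ((norm_mapTensor_le hC h).trans_lt hCD)
  obtain ⟨U, rfl⟩ := exists_mapTensor_eq (p' := p') y
  refine ⟨U, mapTensor_injective (p := p) (by rw [← lTensor_mapTensor, hy]), fun n x => ?_⟩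
  exact (norm_lTensor_le_norm_mapTensor U n x).trans
    (mul_le_mul_of_nonneg_right hyD.le (apply_nonneg _ _))

end Min

/-! ### Maps out of ℓ^1-sums -/

section L1Sum

variable {p : ℝ≥0∞} [Fact (1 ≤ p)] {I : Type*} {X : I → Type*} [∀ i, NormedAddCommGroup (X i)]
  [∀ i, NormedSpace ℝ (X i)]
  {Y : Type*} [NormedAddCommGroup Y] [NormedSpace ℝ Y] [CompleteSpace Y] {NY : PMultinorm p Y}

/-- On an elementary tensor a ⊗ x the cross-norm property reduces this to convergence of ∑ U_i x_i
in Y; the triangle inequality extends it to finite sums. -/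
theorem tendsto_norm_lTensor_sub_sum {U : ∀ i, X i →ₗ[ℝ] Y} {V : lp X 1 →ₗ[ℝ] Y}
    (hV : ∀ x, HasSum (fun i => U i (x i)) (V x)) (n : ℕ) (x : FinLp p n ⊗[ℝ] lp X 1) :
    Filter.Tendsto (fun s : Finset I => NY.norm n (V.lTensor (FinLp p n) x -
      ∑ i ∈ s, (U i).lTensor (FinLp p n) (component p X n i x))) Filter.atTop (nhds 0) := by
  induction x with
  | zero => simp
  | tmul a x =>
    have h : Filter.Tendsto (fun s : Finset I => ‖a‖ * ‖V x - ∑ i ∈ s, U i (x i)‖)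
        Filter.atTop (nhds (‖a‖ * ‖V x - V x‖)) :=
      (tendsto_const_nhds.sub (hV x)).norm.const_mul _
    rw [sub_self, norm_zero, mul_zero] at h
    refine h.congr fun s => ?_
    change _ = NY.norm n (a ⊗ₜ[ℝ] V x - ∑ i ∈ s, a ⊗ₜ[ℝ] U i (x i))
    simp [← TensorProduct.tmul_sum, ← TensorProduct.tmul_sub, norm_tmul]
  | add x y hx hy =>
    have h := hx.add hy
    rw [add_zero] at h
    refine squeeze_zero (fun s => apply_nonneg _ _) (fun s => ?_) h
    refine le_trans (le_of_eq ?_) (map_add_le_add _ _ _)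
    simp only [map_add, Finset.sum_add_distrib]
    congr 1
    abel

variable [∀ i, CompleteSpace (X i)] {N : ∀ i, PMultinorm p (X i)}

open Classical in
-- Only the i-th component survives. Hence restricting a map to a summand does not increase its
-- bound at any level.
theorem norm_lTensor_lsingle (i : I) (n : ℕ) (x : FinLp p n ⊗[ℝ] X i) :
    (l1Sum N).norm n ((lp.lsingle (𝕜 := ℝ) (E := X) 1 i).lTensor (FinLp p n) x) =
      (N i).norm n x := by
  have hc (j : I) : component p X n j
      ((lp.lsingle (𝕜 := ℝ) (E := X) 1 i).lTensor (FinLp p n) x) =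
      (LinearMap.proj j ∘ₗ LinearMap.single ℝ X i).lTensor (FinLp p n) x := by
    rw [component, ← LinearMap.comp_apply, ← LinearMap.lTensor_comp]
    rfl
  change ∑' j, (N j).norm n (component p X n j _) = _
  rw [tsum_eq_single i]
  · rw [hc, LinearMap.proj_comp_single_same, LinearMap.lTensor_id, LinearMap.id_apply]
  · intro j hj
    rw [hc, LinearMap.proj_comp_single_ne _ _ _ _ hj, LinearMap.lTensor_zero,
      LinearMap.zero_apply, map_zero]

/-- A uniformly bounded family of maps `X i → Y` induces a map `(∑ i, X i)_1 → Y`. -/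
theorem exists_hasSum_of_norm_le {U : ∀ i, X i →ₗ[ℝ] Y} {D : ℝ}
    (hU : ∀ i x, ‖U i x‖ ≤ D * ‖x‖) :
    ∃ V : lp X 1 →ₗ[ℝ] Y, ∀ x, HasSum (fun i => U i (x i)) (V x) := by
  have hs (x : lp X 1) : Summable fun i => U i (x i) :=
    Summable.of_norm_bounded ((hasSum_norm_lp_one x).summable.mul_left D) fun i => hU i (x i)
  exact ⟨{
    toFun := fun x => ∑' i, U i (x i)
    map_add' := fun x y => by
      rw [← (hs x).tsum_add (hs y)]
      simp
    map_smul' := fun c x => by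
      rw [RingHom.id_apply, ← (hs x).tsum_const_smul]
      simp }, fun x => (hs x).hasSum⟩

theorem norm_lTensor_le_of_hasSum {U : ∀ i, X i →ₗ[ℝ] Y} {V : lp X 1 →ₗ[ℝ] Y}
    (hV : ∀ x, HasSum (fun i => U i (x i)) (V x)) {D : ℝ} (hD : 0 ≤ D) (n : ℕ)
    (hU : ∀ i x, NY.norm n ((U i).lTensor (FinLp p n) x) ≤ D * (N i).norm n x)
    (x : FinLp p n ⊗[ℝ] lp X 1) :
    NY.norm n (V.lTensor (FinLp p n) x) ≤ D * (l1Sum N).norm n x := by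
  have h := (tendsto_norm_lTensor_sub_sum (NY := NY) hV n x).add_const
    (D * (l1Sum N).norm n x)
  rw [zero_add] at h
  -- It suffices to bound the finite partial sums by D times the norm of x, because the remainder
  -- tends to 0.
  refine ge_of_tendsto' h fun s => ?_
  rw [← sub_le_iff_le_add']
  have h1 : NY.norm n (∑ i ∈ s, (U i).lTensor (FinLp p n) (component p X n i x)) ≤
      D * (l1Sum N).norm n x :=
    calc _ ≤ ∑ i ∈ s, NY.norm n ((U i).lTensor (FinLp p n) (component p X n i x)) :=
          Finset.le_sum_of_subadditive _ (map_zero (NY.norm n)).le (map_add_le_add _) _ _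
      _ ≤ ∑ i ∈ s, D * (N i).norm n (component p X n i x) :=
          Finset.sum_le_sum fun i _ => hU i _
      _ = D * ∑ i ∈ s, (N i).norm n (component p X n i x) := (Finset.mul_sum _ _ _).symm
      _ ≤ D * (l1Sum N).norm n x := mul_le_mul_of_nonneg_left
          ((summable_component N n x).sum_le_tsum s fun i _ => apply_nonneg _ _) hD
  have h2 := map_add_le_add (NY.norm n) (V.lTensor (FinLp p n) x -
      ∑ i ∈ s, (U i).lTensor (FinLp p n) (component p X n i x))
      (∑ i ∈ s, (U i).lTensor (FinLp p n) (component p X n i x))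
  rw [sub_add_cancel] at h2
  linarith

end L1Sum

end PMultinorm

/-! ### Gluing the lifts -/

theorem mainTheorem4 (p p' : ℝ≥0∞) [Fact (1 ≤ p)] [Fact (1 ≤ p')] (hpp' : p⁻¹ + p'⁻¹ = 1)
    {I : Type u} (n : I → ℕ) :
    PMultinorm.IsOneProjective.{u, v, w}
      (PMultinorm.l1Sum fun i => PMultinorm.min p (FinLp p' (n i))) := by
  classical
  intro ε hε Y _ _ _ NY X _ _ _ NX q hq u hu
  have : p.HolderConjugate p' := ENNReal.holderConjugate_iff.mpr hpp'
  set C := (PMultinorm.pNorm (PMultinorm.l1Sum fun i => PMultinorm.min p (FinLp p' (n i)))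
    NX u).toReal with hC_def
  have hC : 0 ≤ C := ENNReal.toReal_nonneg
  have hu' := PMultinorm.norm_lTensor_le hu
  have hlift (i : I) := PMultinorm.exists_lift_min hq
    (T := u ∘ₗ lp.lsingle (𝕜 := ℝ) (E := fun i => FinLp p' (n i)) 1 i) hC
    (lt_add_of_pos_right C hε) fun x => by
      rw [LinearMap.lTensor_comp, LinearMap.comp_apply,
        ← PMultinorm.norm_lTensor_lsingle (N := fun i => PMultinorm.min p (FinLp p' (n i)))]
      exact hu' _ _
  choose U hqU hU using hlift
  obtain ⟨V, hV⟩ := PMultinorm.exists_hasSum_of_norm_le fun i =>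
    PMultinorm.norm_apply_le (hU i 1)
  refine ⟨V, LinearMap.ext fun x => ?_, ?_⟩
  -- The maps q ∘ V and u agree on each summand; continuity of q and u carries this to the
  -- norm-convergent expansion of x, which exists because the exponent 1 is finite.
  · have hq1 : Continuous q := AddMonoidHomClass.continuous_of_bound q 1
      (PMultinorm.norm_apply_le fun y => by simpa using hq.norm_lTensor_le 1 y)
    have hu1 : Continuous u := AddMonoidHomClass.continuous_of_bound u C
      (PMultinorm.norm_apply_le (hu' 1))
    have h1 := (hV x).map q hq1
    have h2 := (lp.hasSum_single ENNReal.one_ne_top x).map u hu1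
    rw [(funext fun i => LinearMap.congr_fun (hqU i) (x i) : (q ∘ fun i => U i (x i)) =
      u ∘ fun i => lp.single 1 i (x i))] at h1
    exact h1.unique h2
  · refine (PMultinorm.pNorm_le (add_nonneg hC hε.le) fun m =>
      PMultinorm.norm_lTensor_le_of_hasSum hV (add_nonneg hC hε.le) m fun i => hU i m).trans ?_
    rw [ENNReal.ofReal_add hC hε.le, hC_def, ENNReal.ofReal_toReal hu.ne]
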